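/- **Setting.** Let $J\subset\mathbb R^d$ be compact with nonempty interior, and let $n_k\ge 2$ be integers and $0<r_k<1$ reals ($k\ge 1$) with $n_kr_k\le 1$ and $r:=\inf_k r_k>0$. Let $D_k=\prod_{j=1}^k\{1,\dots,n_j\}$ and $D=\bigcup_{k\ge 0}D_k$ be the words, $D_0=\{\emptyset\}$. Let $\{J_{\mathbf i}\}_{\mathbf i\in D}$ be a Moran structure: $J_\emptyset=J$; each $J_{\mathbf i}$ is the image of $J$ under a similarity of $\mathbb R^d$; and for $k\ge1$, $\mathbf i\in D_{k-1}$, the sets $J_{\mathbf i1},\dots,J_{\mathbf in_k}$ are subsets of $J_{\mathbf i}$ with pairwise disjoint interiors and $|J_{\mathbf ij}|/|J_{\mathbf i}|=r_k$ for each $j$, where $|\cdot|$ is the diameter. Put $X_0=\{\emptyset\}$, $X_m=\{i_1\cdots i_k\in D: r_1\cdots r_k\le r^m<r_1\cdots r_{k-1}\}$ for $m\ge1$, and $X=\bigcup_{m\ge 0}X_m$, with root $o=\emptyset$. The parent of $\mathbf u\in X_{m+1}$ is its unique prefix in $X_m$. $\mathcal E_v$ is the set of edges joining a vertex and its parent,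 $\mathcal E_h$ is the set of edges joining distinct $\mathbf u,\mathbf v\in X_m$ ($m\ge 1$) with $J_{\mathbf u}\cap J_{\mathbf v}\neq\emptyset$, and $\mathcal E=\mathcal E_v\cup\mathcal E_h$. The graph $(X,\mathcal E)$ is the augmented tree induced by the Moran structure, and $(X,\mathcal E_v)$ is the bare tree. A horizontal component on level $m$ is (the vertex set of) a connected component of $(X,\mathcal E_h)$ contained in $X_m$. Let $\Sigma_m$ be the set of suffixes $\mathbf s$ with $\mathbf u\mathbf s\in X_{m+1}$ for some (equivalently, every) $\mathbf u\in X_m$. $(X,\mathcal E)$ is *rearrangeable* if the cardinalities of the horizontal components are bounded and, for every horizontal component $T$ on a level $m$, with $b=\#T$, the offspring set $T\Sigma_m=\{\mathbf u\mathbf s\in X_{m+1}:\mathbf u\in T,\ \mathbf s\in\Sigma_m\}$ is the union of $b$ disjoint groups of horizontal components on level $m+1$, each group having $\#\Sigma_m$ elements in total. For a connected graph $G$ on $X$ with graph distance $d_G$, let $|x\wedge y|=\frac12(d_G(o,x)+d_G(o,y)-d_G(x,y))$. $G$ is hyperbolic if for some $\delta>0$ one has $|x\wedge y|\ge\min\{|x\wedge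 z|,|z\wedge y|\}-\delta$ for all $x,y,z$. For $a>0$ with $e^{\delta a}-1<\sqrt2-1$ for some such $\delta$ ("$a$ is admissible for $G$"), let $\rho_a(x,y)=e^{-a|x\wedge y|}$ for $x\ne y$ and $\rho_a(x,x)=0$, and equip $X$ with the metric $\theta_a(x,y)=\inf\sum_i\rho_a(x_{i-1},x_i)$ (infimum over finite chains from $x$ to $y$), which is comparable to $\rho_a$ up to constant factors. The hyperbolic boundary is $\partial G=\hat X\setminus X$, where $\hat X$ is the completion of $(X,\theta_a)$, with the extended metric. **Theorem 4.4.** If the augmented tree $(X,\mathcal E)$ is rearrangeable, then $(X,\mathcal E)$ and $(X,\mathcal E_v)$ are hyperbolic, and there is a near-isometry $\sigma:(X,\mathcal E)\to(X,\mathcal E_v)$, i.e. a bijection $\sigma:X\to X$ for which there is a constant $c>0$ with $$\bigl|d_{(X,\mathcal E_v)}(\sigma(x),\sigma(y))-d_{(X,\mathcal E)}(x,y)\bigr|\le c\qquad\text{for all }x,y\in X,$$ such that $\sigma(X_m)\subseteq X_m$ for every $m\ge0$, and for every horizontal component $T$ on a level $m\ge1$ all the vertices $\sigma(x)$, $x\in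 T$, have the same parent. Moreover, for every $a>0$ that is admissible for both graphs, the hyperbolic boundaries $\partial(X,\mathcal E)$ and $\partial(X,\mathcal E_v)$ with parameter $a$ are Lipschitz equivalent: there are a bijection $\tau:\partial(X,\mathcal E)\to\partial(X,\mathcal E_v)$ and $C>0$ with $C^{-1}\operatorname{dist}(\xi,\eta)\le\operatorname{dist}(\tau(\xi),\tau(\eta))\le C\operatorname{dist}(\xi,\eta)$ for all $\xi,\eta$. -/

import Mathlib

open scoped NNReal

noncomputable section

/-! ### Hyperbolic graphs and their boundaries -/

namespace HypGraph

variable {V W : Type*}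

/-- The Gromov product `|x ∧ y| = (|x| + |y| - d(x, y)) / 2` with respect to the root `o`,
where `|x| = d(o, x)` and `d` is the graph distance. -/
def gromovProduct (G : SimpleGraph V) (o x y : V) : ℝ :=
  ((G.dist o x : ℝ) + (G.dist o y : ℝ) - (G.dist x y : ℝ)) / 2

/-- The hyperbolicity inequality with constant `δ`. -/
def HyperbolicWith (G : SimpleGraph V) (o : V) (δ : ℝ) : Prop :=
  ∀ x y z : V,
    min (gromovProduct G o x z) (gromovProduct G o z y) - δ ≤ gromovProduct G o x y

/-- A connected graph that is hyperbolic with respect to the root `o`. -/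
def IsHyperbolic (G : SimpleGraph V) (o : V) : Prop :=
  G.Connected ∧ ∃ δ : ℝ, 0 < δ ∧ HyperbolicWith G o δ

/-- `a > 0` is an admissible parameter for the hyperbolic metric of `G`:
`exp (δ a) - 1 < √2 - 1` for some hyperbolicity constant `δ > 0` of `G`. -/
def Admissible (G : SimpleGraph V) (o : V) (a : ℝ) : Prop :=
  0 < a ∧ ∃ δ : ℝ, 0 < δ ∧ HyperbolicWith G o δ ∧ Real.exp (δ * a) - 1 < √2 - 1

open Classical in
/-- `ρ_a(x, y) = exp (-a |x ∧ y|)` for `x ≠ y`, and `ρ_a(x, x) = 0`. -/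
def rho (G : SimpleGraph V) (o : V) (a : ℝ) (x y : V) : ℝ≥0 :=
  if x = y then 0 else (Real.exp (-a * gromovProduct G o x y)).toNNReal

theorem rho_self (G : SimpleGraph V) (o : V) (a : ℝ) (x : V) : rho G o a x x = 0 := by
  simp [rho]

theorem rho_comm (G : SimpleGraph V) (o : V) (a : ℝ) (x y : V) :
    rho G o a x y = rho G o a y x := by
  have h : gromovProduct G o x y = gromovProduct G o y x := by
    unfold gromovProduct
    rw [SimpleGraph.dist_comm (u := x) (v := y)]
    ring
  unfold rho
  rw [h]
  by_cases hxy : x = y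
  · simp [hxy]
  · rw [if_neg hxy, if_neg (Ne.symm hxy)]

/-- The vertex set of `G`, to be equipped with the hyperbolic metric of parameter `a`. -/
def MetricVertices (_G : SimpleGraph V) (_o : V) (_a : ℝ) : Type _ := V

/-- The hyperbolic metric on the vertices. The function `ρ_a` itself need not satisfy the
triangle inequality; for admissible `a` it is bounded above and below by constant multiples of
the largest (pseudo)metric below it, `θ_a(x, y) = inf ∑ ρ_a(x_{i-1}, x_i)` over all finite chains
`x = x_0, …, x_n = y`, and this is the metric that is used. On a connected graph it separates
points, since `θ_a(x, y) ≥ exp (-a |x|)` for `y ≠ x`. -/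
instance (G : SimpleGraph V) (o : V) (a : ℝ) : PseudoMetricSpace (MetricVertices G o a) :=
  PseudoMetricSpace.ofPreNNDist (X := V) (rho G o a) (rho_self G o a) (rho_comm G o a)

/-- The hyperbolic boundary `∂X = X̂ \ X`, where `X̂` is the metric completion of `X`. As a subset
of the metric space `X̂` it carries the extended metric. -/
def boundary (G : SimpleGraph V) (o : V) (a : ℝ) :
    Set (UniformSpace.Completion (MetricVertices G o a)) :=
  (Set.range ((↑) : MetricVertices G o a → UniformSpace.Completion (MetricVertices G o a)))ᶜ

/-- A bijection that changes graph distances by at most an additive constant. -/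
def IsNearIsometry (G : SimpleGraph V) (H : SimpleGraph W) (σ : V → W) : Prop :=
  Function.Bijective σ ∧
    ∃ c : ℝ, 0 < c ∧ ∀ x y : V, |(H.dist (σ x) (σ y) : ℝ) - (G.dist x y : ℝ)| ≤ c

/-- Lipschitz equivalence: there is a bi-Lipschitz bijection. -/
def LipschitzEquivalent (A B : Type*) [MetricSpace A] [MetricSpace B] : Prop :=
  ∃ τ : A → B, Function.Bijective τ ∧ ∃ C : ℝ, 0 < C ∧
    ∀ x y : A, C⁻¹ * dist x y ≤ dist (τ x) (τ y) ∧ dist (τ x) (τ y) ≤ C * dist x y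

end HypGraph

/-! ### Moran structures and their augmented trees

Words are lists of natural numbers. Indices are counted from `0`: `n k` and `r k` are the number
of pieces and the contraction ratio in the step from words of length `k` to words of length
`k + 1`, and the letters in that step are `0, …, n k - 1`. -/

namespace Moran

/-- The finite words `D = ⋃ D_k`; `D_k` consists of those of length `k`. -/
def IsWord (n : ℕ → ℕ) (w : List ℕ) : Prop :=
  ∀ (k : ℕ) (h : k < w.length), w[k] < n k

/-- A (homogeneous) Moran structure `J_w`, `w ∈ D`, for the triplet `(J, n, r)`, including the
standing assumptions on the triplet. Only the values `F w` at words `w` matter. -/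
structure IsMoranStructure {d : ℕ} (J : Set (EuclideanSpace ℝ (Fin d))) (n : ℕ → ℕ) (r : ℕ → ℝ)
    (F : List ℕ → Set (EuclideanSpace ℝ (Fin d))) : Prop where
  two_le : ∀ k, 2 ≤ n k
  ratio_pos : ∀ k, 0 < r k
  ratio_lt_one : ∀ k, r k < 1
  mul_le_one : ∀ k, (n k : ℝ) * r k ≤ 1
  inf_pos : 0 < ⨅ k, r k
  isCompact : IsCompact J
  interior_nonempty : (interior J).Nonempty
  root_eq : F [] = J
  similar : ∀ w, IsWord n w →
    ∃ S : EuclideanSpace ℝ (Fin d) →ᵈ EuclideanSpace ℝ (Fin d), F w = S '' J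
  subset : ∀ w, IsWord n w → ∀ i < n w.length, F (w ++ [i]) ⊆ F w
  disjoint_interior : ∀ w, IsWord n w → ∀ i < n w.length, ∀ j < n w.length, i ≠ j →
    interior (F (w ++ [i])) ∩ interior (F (w ++ [j])) = ∅
  diam_ratio : ∀ w, IsWord n w → ∀ i < n w.length,
    Metric.diam (F (w ++ [i])) / Metric.diam (F w) = r w.length

/-- The level `X_m`: `X_0` consists of the empty word, and for `m ≥ 1` it is the set of words
`i_1 ⋯ i_k` in `D` with `r_1 ⋯ r_k ≤ r ^ m < r_1 ⋯ r_{k-1}`, where `r = inf r_k`. (The empty word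
never satisfies the first inequality for `m ≥ 1`.) -/
def level (n : ℕ → ℕ) (r : ℕ → ℝ) (m : ℕ) : Set (List ℕ) :=
  if m = 0 then {[]} else
    {w | IsWord n w ∧ ∏ k ∈ Finset.range w.length, r k ≤ (⨅ k, r k) ^ m ∧
      (⨅ k, r k) ^ m < ∏ k ∈ Finset.range (w.length - 1), r k}

/-- The vertex set `X = ⋃ X_m`. -/
def Vertex (n : ℕ → ℕ) (r : ℕ → ℝ) : Type :=
  {w : List ℕ // ∃ m, w ∈ level n r m}

section Tree

variable {n : ℕ → ℕ} {r : ℕ → ℝ}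

/-- The root, i.e. the empty word. -/
def root (n : ℕ → ℕ) (r : ℕ → ℝ) : Vertex n r := ⟨[], 0, by simp [level]⟩

/-- The vertices on level `m`. -/
def levelSet (n : ℕ → ℕ) (r : ℕ → ℝ) (m : ℕ) : Set (Vertex n r) := {x | x.1 ∈ level n r m}

/-- `p = u⁻¹` is the first ancestor of `u`: a prefix of `u` on the previous level. -/
def IsParent (p u : Vertex n r) : Prop :=
  ∃ m, p ∈ levelSet n r m ∧ u ∈ levelSet n r (m + 1) ∧ p.1 <+: u.1

/-- The bare tree `(X, E_v)`. -/
def verticalGraph (n : ℕ → ℕ) (r : ℕ → ℝ) : SimpleGraph (Vertex n r) :=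
  SimpleGraph.fromRel IsParent

/-- The graph `(X, E_h)` of horizontal edges. -/
def horizontalGraph {d : ℕ} (n : ℕ → ℕ) (r : ℕ → ℝ)
    (F : List ℕ → Set (EuclideanSpace ℝ (Fin d))) : SimpleGraph (Vertex n r) :=
  SimpleGraph.fromRel fun u v =>
    ∃ m, 0 < m ∧ u ∈ levelSet n r m ∧ v ∈ levelSet n r m ∧ (F u.1 ∩ F v.1).Nonempty

/-- The augmented tree `(X, E)`, `E = E_v ∪ E_h`. -/
def augmentedTree {d : ℕ} (n : ℕ → ℕ) (r : ℕ → ℝ)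
    (F : List ℕ → Set (EuclideanSpace ℝ (Fin d))) : SimpleGraph (Vertex n r) :=
  verticalGraph n r ⊔ horizontalGraph n r F

/-- `T` is (the vertex set of) a horizontal connected component on the level `X_m`. -/
def IsHorizontalComponent {d : ℕ} (n : ℕ → ℕ) (r : ℕ → ℝ)
    (F : List ℕ → Set (EuclideanSpace ℝ (Fin d))) (m : ℕ) (T : Set (Vertex n r)) : Prop :=
  T ⊆ levelSet n r m ∧ ∃ c : (horizontalGraph n r F).ConnectedComponent, T = c.supp

/-- The set `Σ_m` of suffixes that lead from level `m` to level `m + 1`. -/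
def suffixes (n : ℕ → ℕ) (r : ℕ → ℝ) (m : ℕ) : Set (List ℕ) :=
  {s | ∃ u ∈ level n r m, u ++ s ∈ level n r (m + 1)}

/-- The offspring `T Σ_m` on level `m + 1` of a set `T` of vertices on level `m`. -/
def offspring (m : ℕ) (T : Set (Vertex n r)) : Set (Vertex n r) :=
  {v | v ∈ levelSet n r (m + 1) ∧ ∃ u ∈ T, ∃ s ∈ suffixes n r m, v.1 = u.1 ++ s}

/-- The augmented tree is rearrangeable: the sizes of the horizontal components are bounded, and
for each horizontal component `T` with `b` elements, its offspring are the union of `b` disjoint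
groups of horizontal components, each group having `#Σ` elements in total. -/
def IsRearrangeable {d : ℕ} (n : ℕ → ℕ) (r : ℕ → ℝ)
    (F : List ℕ → Set (EuclideanSpace ℝ (Fin d))) : Prop :=
  (∃ M : ℕ, ∀ m T, IsHorizontalComponent n r F m T → T.encard ≤ M) ∧
  ∀ m T, IsHorizontalComponent n r F m T →
    ∃ Λ : Fin T.ncard → Set (Set (Vertex n r)),
      (∀ s, ∀ Z ∈ Λ s, IsHorizontalComponent n r F (m + 1) Z) ∧
      Pairwise (fun s t => Disjoint (Λ s) (Λ t)) ∧
      offspring m T = ⋃ s, ⋃₀ Λ s ∧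
      ∀ s, (⋃₀ Λ s).encard = (suffixes n r m).encard

end Tree

end Moran

end

noncomputable section

/-! ### Rooted trees and their augmentations -/

/-! Both graphs are the same rooted tree with edges added inside the classes of an equivalence
relation `s` that preserves levels and passes to parents: equality for the bare tree, lying in one
horizontal component for the augmented tree. If equivalent vertices are at distance at most `M`,
then `d(x, y)` equals `|x| + |y| - 2 * meet s x y` up to an error in `[0, M]`, where `meet s x y` is
the deepest level on which the ancestors of `x` and `y` are equivalent (`dist_le`, `le_dist`). Since
`meet s` satisfies the ultrametric inequality, both graphs are hyperbolic, and a level-preserving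
bijection is a near-isometry once it changes meets by a bounded amount.

Rearrangeability gives a map `g` that sends each non-root vertex into the component of its parent,
is constant on components, and takes each value `u` exactly as often as `u` has children
(`exists_assignment`). Building `σ` level by level so that the fibre of `g` over `u` goes
bijectively to the children of `σ u` yields `parent (σ x) = σ (g x)` (`exists_perm_parent_eq`).
Hence the ancestors of `σ x` are images of vertices equivalent to the ancestors of `x`, and meets
change by at most one.

Gromov products then change boundedly, so `σ` is bi-Lipschitz for the hyperbolic metrics and extends
to the completions and their boundaries. -/

/-- A rooted tree, given by its parent map and the distance to the root. -/
structure LeveledTree (V : Type*) where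
  root : V
  parent : V → V
  level : V → ℕ
  level_eq_zero_iff : ∀ x, level x = 0 ↔ x = root
  -- The subtraction is truncated, which makes the root its own parent.
  level_parent : ∀ x, level (parent x) = level x - 1

namespace LeveledTree

variable {V : Type*} (T : LeveledTree V)

/-- The ancestor of `x` on level `k`, for `k ≤ T.level x`. -/
def ancestor (x : V) (k : ℕ) : V := T.parent^[T.level x - k] x

theorem level_root : T.level T.root = 0 := (T.level_eq_zero_iff _).2 rfl

theorem parent_root : T.parent T.root = T.root := by
  rw [← T.level_eq_zero_iff, T.level_parent, T.level_root]

theorem ancestor_level (x : V) : T.ancestor x (T.level x) = x := by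
  simp [ancestor]

theorem level_iterate_parent (x : V) (i : ℕ) : T.level (T.parent^[i] x) = T.level x - i := by
  induction i with
  | zero => rfl
  | succ i ih => rw [Function.iterate_succ_apply', T.level_parent, ih]; omega

theorem level_ancestor {x : V} {k : ℕ} (h : k ≤ T.level x) : T.level (T.ancestor x k) = k := by
  rw [ancestor, level_iterate_parent]; omega

theorem ancestor_zero (x : V) : T.ancestor x 0 = T.root := by
  rw [← T.level_eq_zero_iff, T.level_ancestor (Nat.zero_le _)]

theorem ancestor_parent {x : V} {k : ℕ} (h : k ≤ T.level (T.parent x)) :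
    T.ancestor (T.parent x) k = T.ancestor x k := by
  rcases Nat.eq_zero_or_pos (T.level x) with h0 | h0
  · rw [(T.level_eq_zero_iff x).1 h0, T.parent_root]
  · rw [T.level_parent] at h
    unfold ancestor
    rw [T.level_parent, ← Function.iterate_succ_apply]
    congr 2
    omega

theorem parent_ancestor {x : V} {k : ℕ} (h : k < T.level x) :
    T.parent (T.ancestor x (k + 1)) = T.ancestor x k := by
  unfold ancestor
  rw [← Function.iterate_succ_apply' T.parent]
  congr 2
  omega

/-! ### Meets relative to a compatible equivalence relation. -/

section Meet

variable (s : Setoid V)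

open Classical in
/-- The largest level on which the ancestors of `x` and `y` are equivalent. -/
def meet (x y : V) : ℕ :=
  Nat.findGreatest (fun k => s (T.ancestor x k) (T.ancestor y k)) (min (T.level x) (T.level y))

/-- An equivalence relation that respects levels and passes to parents. -/
structure IsCompatible : Prop where
  level_eq : ∀ {x y}, s x y → T.level x = T.level y
  parent_rel : ∀ {x y}, s x y → s (T.parent x) (T.parent y)

theorem isCompatible_bot : T.IsCompatible ⊥ where
  level_eq h := congrArg T.level h
  parent_rel h := congrArg T.parent h

variable {T s}

theorem IsCompatible.ancestor_rel (hs : T.IsCompatible s) {x y : V} (h : s x y) (k : ℕ) :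
    s (T.ancestor x k) (T.ancestor y k) := by
  unfold ancestor
  rw [hs.level_eq h]
  generalize T.level y - k = i
  induction i with
  | zero => exact h
  | succ i ih =>
    rw [Function.iterate_succ_apply', Function.iterate_succ_apply']
    exact hs.parent_rel ih

theorem ancestor_ancestor {x : V} {j k : ℕ} (hjk : j ≤ k) (hk : k ≤ T.level x) :
    T.ancestor (T.ancestor x k) j = T.ancestor x j := by
  conv_lhs => unfold ancestor
  rw [T.level_iterate_parent, ← Function.iterate_add_apply]
  unfold ancestor
  congr 2
  omega

/-- Equivalence of ancestors descends to all smaller levels and always holds at the root, so the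
levels where it holds form an initial segment. -/
theorem IsCompatible.le_meet_iff (hs : T.IsCompatible s) {x y : V} {k : ℕ} :
    k ≤ T.meet s x y ↔ k ≤ T.level x ∧ k ≤ T.level y ∧ s (T.ancestor x k) (T.ancestor y k) := by
  classical
  constructor
  · intro h
    have hle : T.meet s x y ≤ min (T.level x) (T.level y) := Nat.findGreatest_le _
    have hx : T.meet s x y ≤ T.level x := hle.trans (min_le_left _ _)
    have hy : T.meet s x y ≤ T.level y := hle.trans (min_le_right _ _)
    refine ⟨h.trans hx, h.trans hy, ?_⟩
    have hspec : s (T.ancestor x (T.meet s x y)) (T.ancestor y (T.meet s x y)) := by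
      refine Nat.findGreatest_spec (P := fun k => s (T.ancestor x k) (T.ancestor y k))
        (Nat.zero_le _) ?_
      rw [T.ancestor_zero, T.ancestor_zero]
    have := hs.ancestor_rel hspec k
    rwa [ancestor_ancestor h hx, ancestor_ancestor h hy] at this
  · rintro ⟨hx, hy, h⟩
    exact Nat.le_findGreatest (le_min hx hy) h

theorem IsCompatible.meet_le_left (hs : T.IsCompatible s) (x y : V) :
    T.meet s x y ≤ T.level x := (hs.le_meet_iff.1 le_rfl).1

theorem IsCompatible.meet_le_right (hs : T.IsCompatible s) (x y : V) :
    T.meet s x y ≤ T.level y := (hs.le_meet_iff.1 le_rfl).2.1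

theorem IsCompatible.meet_rel (hs : T.IsCompatible s) (x y : V) :
    s (T.ancestor x (T.meet s x y)) (T.ancestor y (T.meet s x y)) :=
  (hs.le_meet_iff.1 le_rfl).2.2

/-- Transitivity of `s` is what makes the meet ultrametric; this is the source of hyperbolicity. -/
theorem IsCompatible.min_meet_le (hs : T.IsCompatible s) (x y z : V) :
    min (T.meet s x z) (T.meet s z y) ≤ T.meet s x y := by
  obtain ⟨hx, -, hxz⟩ := hs.le_meet_iff.1 (min_le_left (T.meet s x z) (T.meet s z y))
  obtain ⟨-, hy, hzy⟩ := hs.le_meet_iff.1 (min_le_right (T.meet s x z) (T.meet s z y))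
  exact hs.le_meet_iff.2 ⟨hx, hy, s.trans hxz hzy⟩

theorem IsCompatible.meet_self (hs : T.IsCompatible s) (x : V) : T.meet s x x = T.level x :=
  le_antisymm (hs.meet_le_left x x) (hs.le_meet_iff.2 ⟨le_rfl, le_rfl, s.refl _⟩)

/-! ### Distances, Gromov products and hyperbolicity of an augmented tree. -/

/-- `G` arises from the tree by adding edges between equivalent vertices, and equivalent vertices
are joined by walks of length at most `M`. -/
structure IsAugmentation (T : LeveledTree V) (s : Setoid V) (G : SimpleGraph V) (M : ℕ) : Prop
    extends T.IsCompatible s where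
  adj_parent : ∀ {x}, x ≠ T.root → G.Adj x (T.parent x)
  eq_or_rel_of_adj : ∀ {x y}, G.Adj x y → T.parent x = y ∨ T.parent y = x ∨ s x y
  exists_walk : ∀ {x y}, s x y → ∃ p : G.Walk x y, p.length ≤ M

variable {G : SimpleGraph V} {M : ℕ}

theorem IsAugmentation.exists_walk_ancestor (h : T.IsAugmentation s G M) {x : V} {k : ℕ}
    (hk : k ≤ T.level x) : ∃ p : G.Walk x (T.ancestor x k), p.length ≤ T.level x - k := by
  obtain ⟨i, hi⟩ := Nat.exists_eq_add_of_le hk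
  induction i generalizing x with
  | zero =>
    obtain rfl : k = T.level x := by omega
    exact ⟨SimpleGraph.Walk.nil.copy rfl (T.ancestor_level x).symm, by simp⟩
  | succ i ih =>
    have hx : x ≠ T.root := by
      rintro rfl
      rw [T.level_root] at hi
      omega
    have hp := T.level_parent x
    obtain ⟨p, hp'⟩ := ih (x := T.parent x) (by omega) (by omega)
    refine ⟨.cons (h.adj_parent hx) (p.copy rfl (T.ancestor_parent (by omega))), ?_⟩
    simp only [SimpleGraph.Walk.length_cons, SimpleGraph.Walk.length_copy]
    omega

/-- Climb from `x` to the meeting level, cross the class there in at most `M` steps, and descend to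
`y`. -/
theorem IsAugmentation.exists_walk_le (h : T.IsAugmentation s G M) (x y : V) :
    ∃ p : G.Walk x y, p.length + 2 * T.meet s x y ≤ T.level x + T.level y + M := by
  have hx := h.meet_le_left x y
  have hy := h.meet_le_right x y
  obtain ⟨p, hp⟩ := h.exists_walk_ancestor hx
  obtain ⟨q, hq⟩ := h.exists_walk_ancestor hy
  obtain ⟨w, hw⟩ := h.exists_walk (h.meet_rel x y)
  refine ⟨p.append (w.append q.reverse), ?_⟩
  simp only [SimpleGraph.Walk.length_append, SimpleGraph.Walk.length_reverse]
  omega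

/-- With `x` fixed, the quantity `level y - 2 * meet s x y` equals `-level x` at `y = x` and grows
by at most one when `y` moves along an edge. -/
theorem IsAugmentation.level_add_level_le (h : T.IsAugmentation s G M) {x y : V}
    (p : G.Walk y x) : T.level x + T.level y ≤ p.length + 2 * T.meet s x y := by
  induction p with
  | nil => rw [h.meet_self]; omega
  | @cons z y x hadj p ih =>
    rw [SimpleGraph.Walk.length_cons]
    rcases h.eq_or_rel_of_adj hadj with hz | hy | hr
    · have hl := T.level_parent z
      have hm : T.meet s x y ≤ T.meet s x z := by
        obtain ⟨h1, h2, h3⟩ := h.le_meet_iff.1 (le_refl (T.meet s x y))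
        refine h.le_meet_iff.2 ⟨h1, ?_, ?_⟩
        · subst hz; omega
        · subst hz
          rwa [T.ancestor_parent h2] at h3
      subst hz
      omega
    · have hl := T.level_parent y
      -- Moving from `y` to its parent lowers the meet only if the meet was the full level of `y`,
      -- and then by one.
      have hm : min (T.meet s x y) (T.level z) ≤ T.meet s x z := by
        obtain ⟨h1, h2, h3⟩ := h.le_meet_iff.1 (min_le_left (T.meet s x y) (T.level z))
        refine h.le_meet_iff.2 ⟨h1, min_le_right _ _, ?_⟩
        subst hy
        rwa [T.ancestor_parent (min_le_right _ _)]
      subst hy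
      have := h.meet_le_right x y
      have := h.meet_le_left x y
      omega
    · have hl := h.level_eq hr
      have hm : T.meet s x y ≤ T.meet s x z := by
        obtain ⟨h1, h2, h3⟩ := h.le_meet_iff.1 (le_refl (T.meet s x y))
        exact h.le_meet_iff.2 ⟨h1, hl ▸ h2, s.trans h3 (s.symm (h.ancestor_rel hr _))⟩
      omega

theorem IsAugmentation.connected (h : T.IsAugmentation s G M) : G.Connected :=
  haveI : Nonempty V := ⟨T.root⟩
  ⟨fun x y => (h.exists_walk_le x y).elim fun p _ => p.reachable⟩

theorem IsAugmentation.dist_le (h : T.IsAugmentation s G M) (x y : V) :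
    G.dist x y + 2 * T.meet s x y ≤ T.level x + T.level y + M := by
  obtain ⟨p, hp⟩ := h.exists_walk_le x y
  have := SimpleGraph.dist_le p
  omega

theorem IsAugmentation.le_dist (h : T.IsAugmentation s G M) (x y : V) :
    T.level x + T.level y ≤ G.dist x y + 2 * T.meet s x y := by
  obtain ⟨p, hp⟩ := (h.connected y x).exists_walk_length_eq_dist
  rw [G.dist_comm, ← hp]
  exact h.level_add_level_le p

theorem IsAugmentation.dist_root (h : T.IsAugmentation s G M) (x : V) :
    G.dist T.root x = T.level x := by
  apply le_antisymm
  · obtain ⟨p, hp⟩ := h.exists_walk_ancestor (Nat.zero_le (T.level x))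
    have := SimpleGraph.dist_le (p.copy rfl (T.ancestor_zero x)).reverse
    simpa using this.trans (by simpa using hp)
  · have h1 := h.le_dist T.root x
    have h2 := h.meet_le_left T.root x
    rw [T.level_root] at h1 h2
    omega

theorem IsAugmentation.gromovProduct_le (h : T.IsAugmentation s G M) (x y : V) :
    HypGraph.gromovProduct G T.root x y ≤ T.meet s x y := by
  have := h.le_dist x y
  rw [HypGraph.gromovProduct, h.dist_root, h.dist_root]
  have : (T.level x + T.level y : ℝ) ≤ G.dist x y + 2 * T.meet s x y := mod_cast this
  linarith

theorem IsAugmentation.le_gromovProduct (h : T.IsAugmentation s G M) (x y : V) :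
    (T.meet s x y : ℝ) - M / 2 ≤ HypGraph.gromovProduct G T.root x y := by
  have := h.dist_le x y
  rw [HypGraph.gromovProduct, h.dist_root, h.dist_root]
  have : (G.dist x y + 2 * T.meet s x y : ℝ) ≤ T.level x + T.level y + M := mod_cast this
  linarith

theorem IsAugmentation.isHyperbolic (h : T.IsAugmentation s G M) :
    HypGraph.IsHyperbolic G T.root := by
  -- Each Gromov product lies within `M / 2` below the meet; the extra `1` keeps the constant
  -- positive when `M = 0`.
  refine ⟨h.connected, M / 2 + 1, by positivity, fun x y z => ?_⟩
  have h1 : (min (T.meet s x z) (T.meet s z y) : ℝ) ≤ T.meet s x y := mod_cast h.min_meet_le x y z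
  have h2 := min_le_min (h.gromovProduct_le x z) (h.gromovProduct_le z y)
  have h3 := h.le_gromovProduct x y
  linarith

end Meet

end LeveledTree

/-! ### From bounded change of Gromov products to bi-Lipschitz boundaries. -/

namespace HypGraph

variable {V W : Type*}

theorem abs_gromovProduct_sub_le {G : SimpleGraph V} {H : SimpleGraph W} {o : V} {o' : W}
    {σ : V → W} {c : ℝ} (hlev : ∀ x, H.dist o' (σ x) = G.dist o x)
    (hdist : ∀ x y, |(H.dist (σ x) (σ y) : ℝ) - (G.dist x y : ℝ)| ≤ c) (x y : V) :
    |gromovProduct H o' (σ x) (σ y) - gromovProduct G o x y| ≤ c / 2 := by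
  have h := abs_le.1 (hdist x y)
  unfold gromovProduct
  rw [hlev, hlev, abs_le]
  constructor <;> linarith [h.1, h.2]

theorem rho_map_le {G : SimpleGraph V} {H : SimpleGraph W} {o : V} {o' : W} {σ : V → W} {a c : ℝ}
    (ha : 0 < a)
    (hσ : ∀ x y, gromovProduct G o x y - c ≤ gromovProduct H o' (σ x) (σ y)) (x y : V) :
    rho H o' a (σ x) (σ y) ≤ (Real.exp (a * c)).toNNReal * rho G o a x y := by
  unfold rho
  by_cases hxy : x = y
  · simp [hxy]
  by_cases hσxy : σ x = σ y
  · simp [hσxy]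
  rw [if_neg hxy, if_neg hσxy, ← Real.toNNReal_mul (Real.exp_pos _).le, ← Real.exp_add]
  apply Real.toNNReal_le_toNNReal
  apply Real.exp_le_exp.2
  nlinarith [hσ x y]

/-- A map between the vertex sets, as a map between the metric spaces. -/
def metricMap (G : SimpleGraph V) (o : V) (H : SimpleGraph W) (o' : W) (a : ℝ) (σ : V → W) :
    MetricVertices G o a → MetricVertices H o' a := σ

/-- The metric is an infimum of `rho`-sums over chains, so a bound on single steps passes to it by
the triangle inequality. The list `l` in the proof holds the intermediate points of a chain. -/
theorem lipschitzWith_of_nndist_le_rho {G : SimpleGraph V} {o : V} {a : ℝ} {Y : Type*} [PseudoMetricSpace Y]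
    {K : ℝ≥0} (f : MetricVertices G o a → Y)
    (hf : ∀ x y, nndist (f x) (f y) ≤ K * rho G o a x y) : LipschitzWith K f := by
  have chain : ∀ (l : List V) (x y : V),
      nndist (f x) (f y) ≤ K * ((x :: l).zipWith (rho G o a) (l ++ [y])).sum := by
    intro l
    induction l with
    | nil => intro x y; simpa using hf x y
    | cons z l ih =>
      intro x y
      refine (nndist_triangle (f x) (f z) (f y)).trans ?_
      simp only [List.cons_append, List.zipWith_cons_cons, List.sum_cons, mul_add]
      exact add_le_add (hf x z) (by simpa using ih z y)
  refine LipschitzWith.of_dist_le_mul fun (x y : V) => ?_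
  have hd : @dist (MetricVertices G o a) _ x y =
      ((⨅ l : List V, ((x :: l).zipWith (rho G o a) (l ++ [y])).sum : ℝ≥0) : ℝ) :=
    PseudoMetricSpace.dist_ofPreNNDist (X := V) (rho G o a) (rho_self G o a) (rho_comm G o a) x y
  change (_ : ℝ) ≤ (K : ℝ) * @dist (MetricVertices G o a) _ x y
  rw [hd, ← NNReal.coe_mul, NNReal.mul_iInf, ← coe_nndist, NNReal.coe_le_coe]
  exact le_ciInf fun l => chain l x y

theorem lipschitzWith_metricMap {G : SimpleGraph V} {H : SimpleGraph W} {o : V} {o' : W}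
    {σ : V → W} {a c : ℝ} (ha : 0 < a)
    (hσ : ∀ x y, gromovProduct G o x y - c ≤ gromovProduct H o' (σ x) (σ y)) :
    LipschitzWith (Real.exp (a * c)).toNNReal (metricMap G o H o' a σ) := by
  refine lipschitzWith_of_nndist_le_rho _ fun x y => (?_ : _ ≤ rho H o' a (σ x) (σ y)).trans
    (rho_map_le ha hσ x y)
  exact PseudoMetricSpace.dist_ofPreNNDist_le (X := W) (rho H o' a) (rho_self H o' a)
    (rho_comm H o' a) (σ x) (σ y)

open UniformSpace in
/-- A bijection of the vertices that changes Gromov products by a bounded amount extends to a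
bi-Lipschitz bijection of the boundaries. -/
theorem lipschitzEquivalent_boundary {G : SimpleGraph V} {H : SimpleGraph W} {o : V} {o' : W}
    (e : V ≃ W) {a c : ℝ} (ha : 0 < a)
    (he : ∀ x y, |gromovProduct H o' (e x) (e y) - gromovProduct G o x y| ≤ c) :
    LipschitzEquivalent (boundary G o a) (boundary H o' a) := by
  set K := (Real.exp (a * c)).toNNReal
  have hK : 0 < (K : ℝ) := NNReal.coe_pos.2 (Real.toNNReal_pos.2 (Real.exp_pos _))
  set f := metricMap G o H o' a e
  set g := metricMap H o' G o a e.symm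
  have hf : LipschitzWith K f :=
    lipschitzWith_metricMap ha fun x y => by linarith [(abs_le.1 (he x y)).1]
  have hg : LipschitzWith K g := lipschitzWith_metricMap ha fun x y => by
    have := (abs_le.1 (he (e.symm x) (e.symm y))).2
    rw [e.apply_symm_apply, e.apply_symm_apply] at this
    linarith
  have hF := hf.completion_map
  have hG := hg.completion_map
  have hGF : ∀ x, Completion.map g (Completion.map f x) = x := fun x => by
    have := congrFun (Completion.map_comp hg.uniformContinuous hf.uniformContinuous) x
    have hid : g ∘ f = id := funext e.symm_apply_apply
    rwa [hid, Completion.map_id] at this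
  have hFG : ∀ x, Completion.map f (Completion.map g x) = x := fun x => by
    have := congrFun (Completion.map_comp hf.uniformContinuous hg.uniformContinuous) x
    have hid : f ∘ g = id := funext e.apply_symm_apply
    rwa [hid, Completion.map_id] at this
  -- The two extensions are mutually inverse and map vertices to vertices, so a point sent to a
  -- vertex is itself a vertex.
  have hFb : ∀ x ∈ boundary G o a, Completion.map f x ∈ boundary H o' a := by
    rintro x hx ⟨y, hy⟩
    refine hx ⟨g y, ?_⟩
    rw [← Completion.map_coe hg.uniformContinuous, hy, hGF]
  have hGb : ∀ x ∈ boundary H o' a, Completion.map g x ∈ boundary G o a := by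
    rintro x hx ⟨y, hy⟩
    refine hx ⟨f y, ?_⟩
    rw [← Completion.map_coe hf.uniformContinuous, hy, hFG]
  refine ⟨fun x => ⟨Completion.map f x, hFb x x.2⟩, ⟨fun x y hxy => ?_, fun y => ?_⟩, K, hK,
    fun x y => ⟨?_, hF.dist_le_mul x y⟩⟩
  · have := congrArg (Completion.map g) (congrArg Subtype.val hxy)
    exact Subtype.ext (by simpa only [hGF] using this)
  · exact ⟨⟨Completion.map g y, hGb y y.2⟩, Subtype.ext (hFG y)⟩
  · rw [inv_mul_le_iff₀ hK]
    have := hG.dist_le_mul (Completion.map f x) (Completion.map f y)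
    rwa [hGF, hGF] at this

end HypGraph

/-! ### Realising an assignment as the parent map by a permutation. -/

namespace LeveledTree

variable {V : Type*} (T : LeveledTree V)

open Classical in
/-- The map that sends the root to itself and maps `x ≠ root` by `e (g x) (v)`, where `v` is the
image of `g x`. -/
def recMap (g : V → V) (hg : ∀ x, x ≠ T.root → T.level (g x) < T.level x) (e : V → V → V → V)
    (x : V) : V :=
  if h : x = T.root then T.root else
    have := hg x h
    e (g x) (recMap g hg e (g x)) x
termination_by T.level x

/-- The vertices whose parent is `v`. -/
def children (v : V) : Set V := {x | x ≠ T.root ∧ T.parent x = v}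

variable {T} {s : Setoid V}

theorem level_of_ne_root {x : V} (h : x ≠ T.root) : T.level x = T.level (T.parent x) + 1 := by
  have := T.level_parent x
  have := mt (T.level_eq_zero_iff x).1 h
  omega

/-- If the vertices other than the root are reassigned by `g` in such a way that each vertex gets
as many vertices as its level-mates have children, then there is a level-preserving permutation
turning the assignment into the parent map. -/
theorem exists_perm_parent_eq (g : V → V)
    (hg : ∀ x, x ≠ T.root → T.level (g x) = T.level (T.parent x))
    (hfin : ∀ v, (T.children v).Finite)
    (hcard : ∀ u v, T.level u = T.level v →
      {x | x ≠ T.root ∧ g x = u}.encard = (T.children v).encard) :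
    ∃ σ : V ≃ V, (∀ x, T.level (σ x) = T.level x) ∧
      ∀ x, x ≠ T.root → T.parent (σ x) = σ (g x) := by
  -- Bijections are chosen for all pairs on a common level in advance; `v` stands for the value `σ
  -- u`, which is not known yet.
  have hex : ∀ u v, ∃ f : V → V, T.level u = T.level v →
      Set.BijOn f {x | x ≠ T.root ∧ g x = u} (T.children v) := by
    intro u v
    by_cases h : T.level u = T.level v
    · have : Nonempty V := ⟨u⟩
      have hf : {x | x ≠ T.root ∧ g x = u}.Finite := by
        rw [← Set.encard_lt_top_iff, hcard u v h, Set.encard_lt_top_iff]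
        exact hfin v
      obtain ⟨f, hf⟩ := hf.exists_bijOn_of_encard_eq (hcard u v h)
      exact ⟨f, fun _ => hf⟩
    · exact ⟨id, fun h' => absurd h' h⟩
  choose e he using hex
  have hlt : ∀ x, x ≠ T.root → T.level (g x) < T.level x := fun x hx => by
    rw [hg x hx, level_of_ne_root hx]; omega
  set σ := T.recMap g hlt e
  have hσ0 : σ T.root = T.root := by simp only [σ]; rw [recMap]; simp
  have hσ : ∀ x, x ≠ T.root → σ x = e (g x) (σ (g x)) x := fun x hx => by
    simp only [σ]; rw [recMap]; simp [hx]
  -- Levels come first: the chosen map for `u` and `σ u` is a bijection only when both are on the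
  -- same level.
  have hlev : ∀ k x, T.level x = k → T.level (σ x) = k := by
    intro k
    induction k with
    | zero =>
      intro x hx
      rw [(T.level_eq_zero_iff x).1 hx, hσ0, T.level_root]
    | succ k ih =>
      intro x hx
      have hx0 : x ≠ T.root := fun h => by rw [h, T.level_root] at hx; omega
      have h1 := level_of_ne_root hx0
      have h2 := ih (g x) (by rw [hg x hx0]; omega)
      obtain ⟨h3, h4⟩ := (he (g x) (σ (g x)) (by rw [h2, hg x hx0]; omega)).mapsTo ⟨hx0, rfl⟩
      rw [hσ x hx0, level_of_ne_root h3, h4, h2]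
  have hbij : ∀ x, Set.BijOn (e x (σ x)) {y | y ≠ T.root ∧ g y = x} (T.children (σ x)) :=
    fun x => he x (σ x) (hlev _ x rfl).symm
  have hpar : ∀ x, x ≠ T.root → σ x ≠ T.root ∧ T.parent (σ x) = σ (g x) := fun x hx => by
    rw [hσ x hx]
    exact (hbij (g x)).mapsTo ⟨hx, rfl⟩
  have hinj : ∀ k x y, T.level x = k → σ x = σ y → x = y := by
    intro k
    induction k with
    | zero =>
      intro x y hx hxy
      have hy : T.level y = 0 := by rw [← hlev _ y rfl, ← hxy, hlev _ x rfl, hx]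
      rw [(T.level_eq_zero_iff x).1 hx, (T.level_eq_zero_iff y).1 hy]
    | succ k ih =>
      intro x y hx hxy
      have hy : T.level y = k + 1 := by rw [← hlev _ y rfl, ← hxy, hlev _ x rfl, hx]
      have hx0 : x ≠ T.root := fun h => by rw [h, T.level_root] at hx; omega
      have hy0 : y ≠ T.root := fun h => by rw [h, T.level_root] at hy; omega
      -- Equal images have equal parents `σ (g x) = σ (g y)`, so induction puts `x` and `y` in one
      -- fibre of `g`, where `σ` is injective.
      have hgxy : g x = g y := by
        refine ih _ _ ?_ ?_
        · have := level_of_ne_root hx0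
          rw [hg x hx0]; omega
        · rw [← (hpar x hx0).2, ← (hpar y hy0).2, hxy]
      refine (hbij (g x)).injOn ⟨hx0, rfl⟩ ⟨hy0, hgxy.symm⟩ ?_
      rw [← hσ x hx0, hxy, hσ y hy0, hgxy]
  have hsurj : ∀ k y, T.level y = k → ∃ x, σ x = y := by
    intro k
    induction k with
    | zero =>
      intro y hy
      exact ⟨T.root, by rw [hσ0, (T.level_eq_zero_iff y).1 hy]⟩
    | succ k ih =>
      intro y hy
      have hy0 : y ≠ T.root := fun h => by rw [h, T.level_root] at hy; omega
      have := level_of_ne_root hy0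
      obtain ⟨u, hu⟩ := ih (T.parent y) (by omega)
      obtain ⟨x, ⟨hx0, hx⟩, hxy⟩ := (hbij u).surjOn (show y ∈ T.children (σ u) from ⟨hy0, hu.symm⟩)
      refine ⟨x, ?_⟩
      rw [hσ x hx0, hx, hxy]
  exact ⟨Equiv.ofBijective σ ⟨fun x y h => hinj _ x y rfl h, fun y => hsurj _ y rfl⟩,
    fun x => hlev _ x rfl, fun x hx => (hpar x hx).2⟩

/-! ### The permutation changes meets by at most one. -/

section Perm

variable {σ : V ≃ V} {g : V → V}

/-- Going up from `σ z` leads to `σ (g z)`, and `g z` is equivalent to the parent of `z`. The errors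
do not accumulate because `s` is transitive and passes to parents. -/
theorem IsCompatible.exists_ancestor_perm_eq (hs : T.IsCompatible s)
    (hσ : ∀ x, T.level (σ x) = T.level x)
    (hpar : ∀ x, x ≠ T.root → T.parent (σ x) = σ (g x))
    (hg : ∀ x, x ≠ T.root → s (g x) (T.parent x)) {x : V} {k : ℕ} (hk : k ≤ T.level x) :
    ∃ z, s z (T.ancestor x k) ∧ T.ancestor (σ x) k = σ z := by
  induction hk using Nat.decreasingInduction with
  | self =>
    refine ⟨x, ?_, ?_⟩
    · rw [T.ancestor_level]
    · rw [← hσ x, T.ancestor_level]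
  | of_succ k hk ih =>
    obtain ⟨z, hz, hzσ⟩ := ih
    have hz0 : z ≠ T.root := by
      rintro rfl
      have := hs.level_eq hz
      rw [T.level_root, T.level_ancestor hk] at this
      omega
    refine ⟨g z, ?_, ?_⟩
    · rw [← T.parent_ancestor hk]
      exact s.trans (hg z hz0) (hs.parent_rel hz)
    · rw [← T.parent_ancestor (by rw [hσ]; exact hk), hzσ, hpar z hz0]

theorem IsCompatible.meet_perm_le (hs : T.IsCompatible s)
    (hσ : ∀ x, T.level (σ x) = T.level x)
    (hpar : ∀ x, x ≠ T.root → T.parent (σ x) = σ (g x))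
    (hg : ∀ x, x ≠ T.root → s (g x) (T.parent x)) (x y : V) :
    T.meet ⊥ (σ x) (σ y) ≤ T.meet s x y := by
  obtain ⟨hx, hy, h⟩ := T.isCompatible_bot.le_meet_iff.1 (le_refl (T.meet ⊥ (σ x) (σ y)))
  rw [hσ] at hx hy
  obtain ⟨z, hz, hzx⟩ := hs.exists_ancestor_perm_eq hσ hpar hg hx
  obtain ⟨w, hw, hwy⟩ := hs.exists_ancestor_perm_eq hσ hpar hg hy
  have hzw : z = w := σ.injective (by rw [← hzx, ← hwy]; exact h)
  subst hzw
  exact hs.le_meet_iff.2 ⟨hx, hy, s.trans (s.symm hz) hw⟩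

/-- Equivalent `z` and `w` may have different images, but `g z = g w` gives these images the same
parent; this costs one level. -/
theorem IsCompatible.meet_le_meet_perm_add_one (hs : T.IsCompatible s)
    (hσ : ∀ x, T.level (σ x) = T.level x)
    (hpar : ∀ x, x ≠ T.root → T.parent (σ x) = σ (g x))
    (hg : ∀ x, x ≠ T.root → s (g x) (T.parent x))
    (hgs : ∀ x y, x ≠ T.root → s x y → g x = g y) (x y : V) :
    T.meet s x y ≤ T.meet ⊥ (σ x) (σ y) + 1 := by
  obtain ⟨hx, hy, h⟩ := hs.le_meet_iff.1 (le_refl (T.meet s x y))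
  rcases hm : T.meet s x y with _ | k
  · omega
  rw [hm] at hx hy h
  obtain ⟨z, hz, hzx⟩ := hs.exists_ancestor_perm_eq hσ hpar hg hx
  obtain ⟨w, hw, hwy⟩ := hs.exists_ancestor_perm_eq hσ hpar hg hy
  have hzw : s z w := s.trans hz (s.trans h (s.symm hw))
  have hlz := hs.level_eq hz
  rw [T.level_ancestor hx] at hlz
  have hlw := hs.level_eq hzw
  have hz0 : z ≠ T.root := by rintro rfl; rw [T.level_root] at hlz; omega
  have hw0 : w ≠ T.root := by rintro rfl; rw [T.level_root] at hlw; omega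
  refine Nat.succ_le_succ (T.isCompatible_bot.le_meet_iff.2
    ⟨by rw [hσ]; omega, by rw [hσ]; omega, ?_⟩)
  change T.ancestor (σ x) k = T.ancestor (σ y) k
  rw [← T.parent_ancestor (x := σ x) (k := k) (by rw [hσ]; exact hx),
    ← T.parent_ancestor (x := σ y) (k := k) (by rw [hσ]; exact hy), hzx, hwy, hpar z hz0, hpar w hw0, hgs z w hz0 hzw]

/-- The `M` pays for crossing a class in `G`, the `2` for one level of meet, which counts twice in
the distance. -/
theorem IsAugmentation.abs_dist_sub_le {G H : SimpleGraph V} {M : ℕ}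
    (hG : T.IsAugmentation s G M) (hH : T.IsAugmentation ⊥ H 0)
    (hσ : ∀ x, T.level (σ x) = T.level x)
    (hpar : ∀ x, x ≠ T.root → T.parent (σ x) = σ (g x))
    (hg : ∀ x, x ≠ T.root → s (g x) (T.parent x))
    (hgs : ∀ x y, x ≠ T.root → s x y → g x = g y) (x y : V) :
    |(H.dist (σ x) (σ y) : ℝ) - (G.dist x y : ℝ)| ≤ M + 2 := by
  have h1 := hG.dist_le x y
  have h2 := hG.le_dist x y
  have h3 := hH.dist_le (σ x) (σ y)
  have h4 := hH.le_dist (σ x) (σ y)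
  have h5 := hG.toIsCompatible.meet_perm_le hσ hpar hg x y
  have h6 := hG.toIsCompatible.meet_le_meet_perm_add_one hσ hpar hg hgs x y
  rw [hσ, hσ] at h3 h4
  have h7 : H.dist (σ x) (σ y) ≤ G.dist x y + (M + 2) := by omega
  have h8 : G.dist x y ≤ H.dist (σ x) (σ y) + (M + 2) := by omega
  have h7' : (H.dist (σ x) (σ y) : ℝ) ≤ G.dist x y + (M + 2) := mod_cast h7
  have h8' : (G.dist x y : ℝ) ≤ H.dist (σ x) (σ y) + (M + 2) := mod_cast h8
  rw [abs_le]
  constructor <;> linarith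

end Perm

end LeveledTree

/-! ### Words of a Moran structure and the lengths occurring on each level. -/

namespace Moran

variable {n : ℕ → ℕ} {r : ℕ → ℝ}

theorem isWord_append {u t : List ℕ} :
    IsWord n (u ++ t) ↔ IsWord n u ∧ ∀ (j : ℕ) (h : j < t.length), t[j] < n (u.length + j) := by
  constructor
  · refine fun h => ⟨fun k hk => ?_, fun j hj => ?_⟩
    · have := h k (by rw [List.length_append]; omega)
      rwa [List.getElem_append_left hk] at this
    · have := h (u.length + j) (by rw [List.length_append]; omega)
      rw [List.getElem_append_right (by omega)] at this
      simpa using this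
  · rintro ⟨hu, ht⟩ k hk
    rw [List.length_append] at hk
    rcases lt_or_ge k u.length with h | h
    · rw [List.getElem_append_left h]
      exact hu k h
    · rw [List.getElem_append_right h]
      have := ht (k - u.length) (by omega)
      rwa [Nat.add_sub_cancel' h] at this

theorem IsWord.take {w : List ℕ} (h : IsWord n w) (k : ℕ) : IsWord n (w.take k) := by
  rw [← List.take_append_drop k w] at h
  exact (isWord_append.1 h).1

theorem finite_setOf_isWord (n : ℕ → ℕ) (k : ℕ) : {w | IsWord n w ∧ w.length = k}.Finite := by
  induction k with
  | zero =>
    refine (Set.finite_singleton []).subset fun w hw => ?_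
    exact List.length_eq_zero_iff.1 hw.2
  | succ k ih =>
    refine (ih.image2 (fun u i => u ++ [i]) (Set.finite_Iio (n k))).subset ?_
    rintro w ⟨hw, hk⟩
    rcases List.eq_nil_or_concat' w with rfl | ⟨u, i, rfl⟩
    · simp at hk
    · rw [isWord_append] at hw
      have hu : u.length = k := by simpa using hk
      refine ⟨u, ⟨hw.1, hu⟩, i, ?_, rfl⟩
      simpa [hu] using hw.2 0 (by simp)

/-- The length of the words on level `m`. -/
def wordLength (r : ℕ → ℝ) (m : ℕ) : ℕ :=
  sInf {k | ∏ i ∈ Finset.range k, r i ≤ (⨅ i, r i) ^ m}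

theorem wordLength_zero : wordLength r 0 = 0 := by
  unfold wordLength
  simp [Nat.sInf_eq_zero]

theorem lt_prod_of_lt_wordLength {m k : ℕ} (h : k < wordLength r m) :
    (⨅ i, r i) ^ m < ∏ i ∈ Finset.range k, r i :=
  not_le.1 fun hk => Nat.notMem_of_lt_sInf h hk

namespace IsMoranStructure

variable {d : ℕ} {J : Set (EuclideanSpace ℝ (Fin d))} {F : List ℕ → Set (EuclideanSpace ℝ (Fin d))}
  (hF : IsMoranStructure J n r F)

include hF

/-- This uniform bound drives the products of ratios to zero, so the infimum defining `wordLength`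
is attained. -/
theorem ratio_le_half (k : ℕ) : r k ≤ 1 / 2 := by
  have h1 : (2 : ℝ) ≤ n k := mod_cast hF.two_le k
  nlinarith [hF.mul_le_one k, hF.ratio_pos k]

theorem iInf_le_ratio (k : ℕ) : ⨅ i, r i ≤ r k :=
  ciInf_le ⟨0, by rintro _ ⟨i, rfl⟩; exact (hF.ratio_pos i).le⟩ k

theorem prod_pos (k : ℕ) : 0 < ∏ i ∈ Finset.range k, r i :=
  Finset.prod_pos fun i _ => hF.ratio_pos i

theorem antitone_prod : Antitone fun k => ∏ i ∈ Finset.range k, r i :=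
  antitone_nat_of_succ_le fun k => by
    rw [Finset.prod_range_succ]
    exact mul_le_of_le_one_right (hF.prod_pos k).le (hF.ratio_lt_one k).le

theorem prod_wordLength_le (m : ℕ) :
    ∏ i ∈ Finset.range (wordLength r m), r i ≤ (⨅ i, r i) ^ m := by
  refine Nat.sInf_mem (s := {k | ∏ i ∈ Finset.range k, r i ≤ (⨅ i, r i) ^ m}) ?_
  obtain ⟨k, hk⟩ := exists_pow_lt_of_lt_one (pow_pos hF.inf_pos m) (one_half_lt_one (α := ℝ))
  refine ⟨k, le_trans ?_ hk.le⟩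
  simpa using Finset.prod_le_prod (s := Finset.range k) (fun i _ => (hF.ratio_pos i).le)
    fun i _ => hF.ratio_le_half i

theorem wordLength_le_iff {m k : ℕ} :
    wordLength r m ≤ k ↔ ∏ i ∈ Finset.range k, r i ≤ (⨅ i, r i) ^ m :=
  ⟨fun h => (hF.antitone_prod h).trans (hF.prod_wordLength_le m), fun h => Nat.sInf_le h⟩

/-- Before its last letter a word of level `m` still has ratio above `r ^ m`, and the last factor is
at least `r`, so the full ratio exceeds `r ^ (m + 1)`. Thus distinct levels are disjoint. -/
theorem strictMono_wordLength : StrictMono (wordLength r) := by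
  refine strictMono_nat_of_lt_succ fun m => ?_
  rw [← not_le, hF.wordLength_le_iff, not_le, pow_succ]
  have hinf := hF.inf_pos
  -- Length `0` has no last letter; there the ratio is `1` and `r < 1` suffices.
  rcases hk : wordLength r m with _ | k
  · have h1 : (⨅ i, r i) < 1 := (hF.iInf_le_ratio 0).trans_lt (hF.ratio_lt_one 0)
    rw [Finset.prod_range_zero, ← pow_succ]
    exact pow_lt_one₀ hinf.le h1 (by omega)
  · rw [Finset.prod_range_succ]
    exact mul_lt_mul (lt_prod_of_lt_wordLength (by omega)) (hF.iInf_le_ratio k) hinf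
      (hF.prod_pos k).le

/-- The defining inequalities see a word only through its length and single out the least length
with ratio at most `r ^ m`. -/
theorem mem_level_iff {m : ℕ} {w : List ℕ} :
    w ∈ level n r m ↔ IsWord n w ∧ w.length = wordLength r m := by
  rcases Nat.eq_zero_or_pos m with rfl | hm
  · rw [wordLength_zero, List.length_eq_zero_iff]
    simp only [level, if_true, Set.mem_singleton_iff]
    refine ⟨?_, And.right⟩
    rintro rfl
    exact ⟨fun k h => absurd h (by simp), rfl⟩
  · simp only [level, if_neg hm.ne', Set.mem_ofPred_eq]
    refine and_congr_right fun _ => ?_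
    have hpos : 0 < wordLength r m := by
      have := hF.strictMono_wordLength hm
      omega
    rw [← hF.wordLength_le_iff, ← not_le, ← hF.wordLength_le_iff]
    omega

/-- The level of a vertex. -/
def vertexLevel (_hF : IsMoranStructure J n r F) (x : Vertex n r) : ℕ := x.2.choose

theorem mem_levelSet_iff {m : ℕ} {x : Vertex n r} :
    x ∈ levelSet n r m ↔ hF.vertexLevel x = m := by
  have hx : x.1 ∈ level n r (hF.vertexLevel x) := x.2.choose_spec
  constructor
  · intro h
    exact hF.strictMono_wordLength.injective
      ((hF.mem_level_iff.1 hx).2.symm.trans (hF.mem_level_iff.1 h).2)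
  · rintro rfl
    exact hx

theorem isWord (x : Vertex n r) : IsWord n x.1 :=
  (hF.mem_level_iff.1 (hF.mem_levelSet_iff.2 rfl : x ∈ levelSet n r _)).1

theorem length_eq (x : Vertex n r) : x.1.length = wordLength r (hF.vertexLevel x) :=
  (hF.mem_level_iff.1 (hF.mem_levelSet_iff.2 rfl : x ∈ levelSet n r _)).2

theorem take_mem_level (x : Vertex n r) :
    x.1.take (wordLength r (hF.vertexLevel x - 1)) ∈ level n r (hF.vertexLevel x - 1) := by
  refine hF.mem_level_iff.2 ⟨(hF.isWord x).take _, ?_⟩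
  rw [List.length_take, hF.length_eq]
  exact min_eq_left (hF.strictMono_wordLength.monotone (Nat.sub_le _ _))

/-! ### The bare and augmented trees as augmentations of one leveled tree. -/

/-- The bare tree of a Moran structure. -/
def tree : LeveledTree (Vertex n r) where
  root := root n r
  parent x := ⟨x.1.take (wordLength r (hF.vertexLevel x - 1)), _, hF.take_mem_level x⟩
  level := hF.vertexLevel
  level_eq_zero_iff x := by
    rw [← hF.mem_levelSet_iff]
    refine ⟨fun h => Subtype.ext ?_, ?_⟩
    · have h' : x.1 ∈ level n r 0 := h
      rwa [level, if_pos rfl, Set.mem_singleton_iff] at h'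
    · rintro rfl
      change ([] : List ℕ) ∈ level n r 0
      rw [level, if_pos rfl, Set.mem_singleton_iff]
  level_parent x := hF.mem_levelSet_iff.1 (hF.take_mem_level x)

theorem mem_levelSet_tree {m : ℕ} {x : Vertex n r} :
    x ∈ levelSet n r m ↔ hF.tree.level x = m := hF.mem_levelSet_iff

theorem tree_parent_val (x : Vertex n r) :
    (hF.tree.parent x).1 = x.1.take (wordLength r (hF.tree.level x - 1)) := rfl

theorem isParent_iff {p u : Vertex n r} :
    IsParent p u ↔ u ≠ hF.tree.root ∧ hF.tree.parent u = p := by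
  constructor
  · rintro ⟨m, hp, hu, hpu⟩
    have hpm := hF.mem_levelSet_tree.1 hp
    have hum := hF.mem_levelSet_tree.1 hu
    refine ⟨?_, Subtype.ext ?_⟩
    · rintro rfl
      rw [hF.tree.level_root] at hum
      omega
    · rw [List.prefix_iff_eq_take.1 hpu, hF.tree_parent_val, hum, hF.length_eq p,
        hF.mem_levelSet_iff.1 hp, Nat.add_sub_cancel]
  · rintro ⟨hu, rfl⟩
    refine ⟨hF.tree.level (hF.tree.parent u), hF.mem_levelSet_tree.2 rfl,
      hF.mem_levelSet_tree.2 (LeveledTree.level_of_ne_root hu), List.take_prefix _ _⟩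

theorem verticalGraph_adj_parent {x : Vertex n r} (hx : x ≠ hF.tree.root) :
    (verticalGraph n r).Adj x (hF.tree.parent x) := by
  refine (SimpleGraph.fromRel_adj _ _ _).2 ⟨fun h => ?_, .inr (hF.isParent_iff.2 ⟨hx, rfl⟩)⟩
  have := LeveledTree.level_of_ne_root hx
  rw [← h] at this
  omega

theorem parent_eq_of_verticalGraph_adj {x y : Vertex n r} (h : (verticalGraph n r).Adj x y) :
    hF.tree.parent x = y ∨ hF.tree.parent y = x := by
  rcases ((SimpleGraph.fromRel_adj _ _ _).1 h).2 with h | h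
  · exact .inr (hF.isParent_iff.1 h).2
  · exact .inl (hF.isParent_iff.1 h).2

theorem isAugmentation_verticalGraph :
    hF.tree.IsAugmentation ⊥ (verticalGraph n r) 0 where
  toIsCompatible := hF.tree.isCompatible_bot
  adj_parent := hF.verticalGraph_adj_parent
  eq_or_rel_of_adj h := (hF.parent_eq_of_verticalGraph_adj h).imp_right .inl
  exists_walk := by
    rintro x y (rfl : x = y)
    exact ⟨.nil, le_rfl⟩

theorem subset_of_append {u t : List ℕ} (h : IsWord n (u ++ t)) : F (u ++ t) ⊆ F u := by
  induction t using List.reverseRecOn with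
  | nil => simp
  | append_singleton t i ih =>
    rw [← List.append_assoc] at h ⊢
    obtain ⟨h1, h2⟩ := isWord_append.1 h
    exact (hF.subset _ h1 i (by simpa using h2 0 (by simp))).trans (ih h1)

theorem subset_parent (x : Vertex n r) : F x.1 ⊆ F (hF.tree.parent x).1 := by
  rw [hF.tree_parent_val]
  have h := hF.isWord x
  rw [← List.take_append_drop (wordLength r (hF.tree.level x - 1)) x.1] at h
  have := hF.subset_of_append h
  rwa [List.take_append_drop] at this

theorem level_eq_of_horizontalGraph_adj {x y : Vertex n r} (h : (horizontalGraph n r F).Adj x y) :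
    hF.tree.level x = hF.tree.level y ∧ (F x.1 ∩ F y.1).Nonempty := by
  rcases ((SimpleGraph.fromRel_adj _ _ _).1 h).2 with ⟨m, -, hx, hy, hxy⟩ | ⟨m, -, hx, hy, hxy⟩
  · exact ⟨(hF.mem_levelSet_tree.1 hx).trans (hF.mem_levelSet_tree.1 hy).symm, hxy⟩
  · rw [Set.inter_comm]
    exact ⟨(hF.mem_levelSet_tree.1 hy).trans (hF.mem_levelSet_tree.1 hx).symm, hxy⟩

theorem reachable_of_inter_nonempty {x y : Vertex n r} (h : hF.tree.level x = hF.tree.level y)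
    (hxy : (F x.1 ∩ F y.1).Nonempty) : (horizontalGraph n r F).Reachable x y := by
  by_cases hne : x = y
  · rw [hne]
  rcases Nat.eq_zero_or_pos (hF.tree.level x) with h0 | h0
  · exact absurd (((hF.tree.level_eq_zero_iff x).1 h0).trans
      ((hF.tree.level_eq_zero_iff y).1 (h ▸ h0)).symm) hne
  · exact SimpleGraph.Adj.reachable ((SimpleGraph.fromRel_adj _ _ _).2
      ⟨hne, .inl ⟨_, h0, hF.mem_levelSet_tree.2 rfl, hF.mem_levelSet_tree.2 h.symm, hxy⟩⟩)

/-- A cell lies inside its parent cell, so cells that meet have parent cells that meet, and a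
horizontal path projects to the previous level. -/
theorem isCompatible_horizontalGraph :
    hF.tree.IsCompatible (horizontalGraph n r F).reachableSetoid where
  level_eq := by
    rintro x y ⟨p⟩
    induction p with
    | nil => rfl
    | cons h p ih => exact (hF.level_eq_of_horizontalGraph_adj h).1.trans ih
  parent_rel := by
    rintro x y ⟨p⟩
    induction p with
    | nil => exact SimpleGraph.Reachable.refl _
    | cons h p ih =>
      obtain ⟨h1, h2⟩ := hF.level_eq_of_horizontalGraph_adj h
      refine SimpleGraph.Reachable.trans (hF.reachable_of_inter_nonempty ?_ ?_) ih
      · rw [hF.tree.level_parent, hF.tree.level_parent, h1]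
      · exact h2.mono (Set.inter_subset_inter (hF.subset_parent _) (hF.subset_parent _))

theorem isHorizontalComponent_supp (x : Vertex n r) :
    IsHorizontalComponent n r F (hF.tree.level x)
      ((horizontalGraph n r F).connectedComponentMk x).supp := by
  refine ⟨fun y hy => hF.mem_levelSet_tree.2 ?_, _, rfl⟩
  exact hF.isCompatible_horizontalGraph.level_eq (SimpleGraph.ConnectedComponent.exact hy)

/-- A horizontal path visits distinct vertices of a single component, so it has fewer than `M`
edges. -/
theorem isAugmentation_augmentedTree {M : ℕ}
    (hM : ∀ m T, IsHorizontalComponent n r F m T → T.encard ≤ M) :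
    hF.tree.IsAugmentation (horizontalGraph n r F).reachableSetoid (augmentedTree n r F) M where
  toIsCompatible := hF.isCompatible_horizontalGraph
  adj_parent hx := SimpleGraph.sup_adj .. |>.2 (.inl (hF.verticalGraph_adj_parent hx))
  eq_or_rel_of_adj h := by
    rcases (SimpleGraph.sup_adj ..).1 h with h | h
    · exact (hF.parent_eq_of_verticalGraph_adj h).imp_right .inl
    · exact .inr (.inr (SimpleGraph.Adj.reachable h))
  exists_walk := by
    classical
    rintro x y (h : (horizontalGraph n r F).Reachable x y)
    obtain ⟨p, hp⟩ := h.exists_isPath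
    have hle : horizontalGraph n r F ≤ augmentedTree n r F := le_sup_right
    refine ⟨p.mapLe hle, ?_⟩
    have hsub : (p.support.toFinset : Set (Vertex n r)) ⊆
        ((horizontalGraph n r F).connectedComponentMk x).supp := by
      intro z hz
      rw [List.coe_toFinset, Set.mem_ofPred_eq] at hz
      exact SimpleGraph.ConnectedComponent.sound (p.takeUntil z hz).reachable.symm
    have hcard := (Set.encard_le_encard hsub).trans (hM _ _ (hF.isHorizontalComponent_supp x))
    rw [Set.encard_coe_eq_coe_finsetCard, List.toFinset_card_of_nodup hp.support_nodup,
      SimpleGraph.Walk.length_support] at hcard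
    have : p.length + 1 ≤ M := mod_cast hcard
    have : (p.mapLe hle).length = p.length := SimpleGraph.Walk.length_map _ _
    omega

/-- Admissibility of a suffix depends only on the length of the word before it, and that length is
constant on a level. -/
theorem append_mem_level {m : ℕ} {v t : List ℕ} (hv : v ∈ level n r m)
    (ht : t ∈ suffixes n r m) : v ++ t ∈ level n r (m + 1) := by
  obtain ⟨u, hu, hut⟩ := ht
  rw [hF.mem_level_iff] at hv hu hut ⊢
  rw [isWord_append, List.length_append] at hut ⊢
  exact ⟨⟨hv.1, by rw [hv.2, ← hu.2]; exact hut.1.2⟩, by omega⟩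

theorem drop_mem_suffixes {x : Vertex n r} (hx : x ≠ hF.tree.root) :
    ∃ t ∈ suffixes n r (hF.tree.level (hF.tree.parent x)), x.1 = (hF.tree.parent x).1 ++ t := by
  have h : x.1 = (hF.tree.parent x).1 ++ x.1.drop (wordLength r (hF.tree.level x - 1)) := by
    rw [hF.tree_parent_val, List.take_append_drop]
  refine ⟨_, ⟨(hF.tree.parent x).1, hF.mem_levelSet_tree.2 rfl, ?_⟩, h⟩
  rw [← h]
  exact hF.mem_levelSet_tree.2 (LeveledTree.level_of_ne_root hx)

theorem parent_eq_of_append {m : ℕ} {x u : Vertex n r} {t : List ℕ} (hx : x ∈ levelSet n r (m + 1))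
    (hu : u ∈ levelSet n r m) (h : x.1 = u.1 ++ t) : x ≠ hF.tree.root ∧ hF.tree.parent x = u :=
  hF.isParent_iff.1 ⟨m, hu, hx, h ▸ List.prefix_append _ _⟩

theorem image_children (v : Vertex n r) :
    Subtype.val '' hF.tree.children v = (v.1 ++ ·) '' suffixes n r (hF.tree.level v) := by
  ext w
  constructor
  · rintro ⟨x, ⟨hx, rfl⟩, rfl⟩
    obtain ⟨t, ht, h⟩ := hF.drop_mem_suffixes hx
    exact ⟨t, ht, h.symm⟩
  · rintro ⟨t, ht, rfl⟩
    have hmem := hF.append_mem_level (hF.mem_levelSet_tree.2 rfl) ht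
    exact ⟨⟨_, _, hmem⟩, hF.parent_eq_of_append hmem (hF.mem_levelSet_tree.2 rfl) rfl, rfl⟩

theorem encard_children (v : Vertex n r) :
    (hF.tree.children v).encard = (suffixes n r (hF.tree.level v)).encard := by
  have hval : Function.Injective (Subtype.val : Vertex n r → List ℕ) := Subtype.val_injective
  refine (hval.encard_image (hF.tree.children v)).symm.trans ?_
  refine (congrArg Set.encard (hF.image_children v)).trans ?_
  exact (List.append_right_injective v.1).encard_image _

theorem finite_children (v : Vertex n r) : (hF.tree.children v).Finite := by
  refine Set.Finite.of_finite_image ?_ Subtype.val_injective.injOn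
  refine (finite_setOf_isWord n (wordLength r (hF.tree.level v + 1))).subset ?_
  rintro _ ⟨x, ⟨hx, rfl⟩, rfl⟩
  refine ⟨hF.isWord x, ?_⟩
  rw [hF.length_eq x, ← LeveledTree.level_of_ne_root hx]
  rfl

theorem offspring_supp (v : Vertex n r) :
    offspring (hF.tree.level v) ((horizontalGraph n r F).connectedComponentMk v).supp =
      {x | x ≠ hF.tree.root ∧ (horizontalGraph n r F).Reachable (hF.tree.parent x) v} := by
  ext x
  constructor
  · rintro ⟨hx, u, hu, t, -, h⟩
    obtain ⟨hx0, rfl⟩ :=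
      hF.parent_eq_of_append hx ((hF.isHorizontalComponent_supp v).1 hu) h
    exact ⟨hx0, SimpleGraph.ConnectedComponent.exact hu⟩
  · rintro ⟨hx, h⟩
    have hl : hF.tree.level (hF.tree.parent x) = hF.tree.level v :=
      hF.isCompatible_horizontalGraph.level_eq h
    obtain ⟨t, ht, hxt⟩ := hF.drop_mem_suffixes hx
    rw [hl] at ht
    refine ⟨hF.mem_levelSet_tree.2 ?_, _, SimpleGraph.ConnectedComponent.sound h, t, ht, hxt⟩
    rw [LeveledTree.level_of_ne_root hx, hl]

/-! ### Distributing offspring within horizontal components. -/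

/-- In a rearrangeable tree, the offspring of a horizontal component can be distributed to the
elements of the component so that each receives the same number, and so that offspring in the same
horizontal component go to the same element. -/
theorem exists_assignment_of_component (hR : IsRearrangeable n r F)
    (c : (horizontalGraph n r F).ConnectedComponent) :
    ∃ g : Vertex n r → Vertex n r,
      (∀ x, x ≠ hF.tree.root →
        (horizontalGraph n r F).connectedComponentMk (hF.tree.parent x) = c →
        (horizontalGraph n r F).connectedComponentMk (g x) = c) ∧
      (∀ x y, x ≠ hF.tree.root →
        (horizontalGraph n r F).connectedComponentMk (hF.tree.parent x) = c →
        (horizontalGraph n r F).Reachable x y → g x = g y) ∧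
      ∀ u, (horizontalGraph n r F).connectedComponentMk u = c →
        {x | x ≠ hF.tree.root ∧
          (horizontalGraph n r F).connectedComponentMk (hF.tree.parent x) = c ∧ g x = u}.encard =
            (suffixes n r (hF.tree.level u)).encard := by
  induction c using SimpleGraph.ConnectedComponent.ind with | _ v
  set H := horizontalGraph n r F
  set S := (H.connectedComponentMk v).supp
  have hS := hF.isHorizontalComponent_supp v
  obtain ⟨⟨M, hM⟩, hΛ⟩ := hR
  obtain ⟨Λ, hcomp, hdisj, hoff, hcard⟩ := hΛ _ _ hS
  rw [hF.offspring_supp v] at hoff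
  have hfin : S.Finite := Set.encard_lt_top_iff.1 ((hM _ _ hS).trans_lt (ENat.natCast_lt_top M))
  have : Finite S := hfin
  -- The groups are matched with the elements of the component arbitrarily; `g` sends each group to
  -- its partner.
  let e : S ≃ Fin S.ncard := Finite.equivFinOfCardEq rfl
  -- The groups are disjoint as families of components; since distinct components do not meet, their
  -- unions are disjoint too.
  have huniq : ∀ i j x, x ∈ ⋃₀ Λ i → x ∈ ⋃₀ Λ j → i = j := by
    rintro i j x ⟨Z, hZ, hxZ⟩ ⟨Z', hZ', hxZ'⟩
    by_contra hij
    obtain ⟨-, a, rfl⟩ := hcomp i Z hZ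
    obtain ⟨-, b, rfl⟩ := hcomp j Z' hZ'
    have hab : a = b := hxZ.symm.trans hxZ'
    exact Set.disjoint_left.1 (hdisj hij) hZ (hab ▸ hZ')
  have hmem : ∀ x, x ≠ hF.tree.root →
      H.connectedComponentMk (hF.tree.parent x) = H.connectedComponentMk v →
      ∃ i, x ∈ ⋃₀ Λ i := fun x hx h => by
    have : x ∈ ⋃ i, ⋃₀ Λ i := hoff ▸ ⟨hx, SimpleGraph.ConnectedComponent.exact h⟩
    exact Set.mem_iUnion.1 this
  have hmem' : ∀ i x, x ∈ ⋃₀ Λ i → x ≠ hF.tree.root ∧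
      H.connectedComponentMk (hF.tree.parent x) = H.connectedComponentMk v := fun i x hx => by
    obtain ⟨h1, h2⟩ := hoff.symm ▸ Set.mem_iUnion.2 ⟨i, hx⟩
    exact ⟨h1, SimpleGraph.ConnectedComponent.sound h2⟩
  -- Outside the offspring of the component the value is immaterial, and `x` itself serves as
  -- default.
  have hex : ∀ x, ∃ u, ∀ i, x ∈ ⋃₀ Λ i → u = (e.symm i : Vertex n r) := fun x => by
    by_cases h : ∃ i, x ∈ ⋃₀ Λ i
    · obtain ⟨i, hi⟩ := h
      exact ⟨e.symm i, fun j hj => by rw [huniq i j x hi hj]⟩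
    · exact ⟨x, fun i hi => absurd ⟨i, hi⟩ h⟩
  choose g hg using hex
  refine ⟨g, fun x hx h => ?_, fun x y hx h hxy => ?_, fun u hu => ?_⟩
  · obtain ⟨i, hi⟩ := hmem x hx h
    rw [hg x i hi]
    exact (e.symm i).2
  · obtain ⟨i, hi⟩ := hmem x hx h
    have hy : y ∈ ⋃₀ Λ i := by
      obtain ⟨Z, hZ, hxZ⟩ := hi
      refine ⟨Z, hZ, ?_⟩
      obtain ⟨-, a, rfl⟩ := hcomp i Z hZ
      exact (SimpleGraph.ConnectedComponent.sound hxy.symm).trans hxZ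
    rw [hg x i hi, hg y i hy]
  · have hul := hF.mem_levelSet_tree.1 (hS.1 hu)
    rw [hul, ← hcard (e ⟨u, hu⟩)]
    congr 1
    ext x
    constructor
    · rintro ⟨hx, hxc, hxu⟩
      obtain ⟨i, hi⟩ := hmem x hx hxc
      have : (⟨u, hu⟩ : S) = e.symm i := Subtype.ext (hxu.symm.trans (hg x i hi))
      rwa [this, e.apply_symm_apply]
    · intro hx
      obtain ⟨h1, h2⟩ := hmem' _ x hx
      exact ⟨h1, h2, by rw [hg x _ hx, e.symm_apply_apply]⟩

/-- The local assignments are glued along the component of the parent, which is the same for all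
vertices of one component. -/
theorem exists_assignment (hR : IsRearrangeable n r F) :
    ∃ g : Vertex n r → Vertex n r,
      (∀ x, x ≠ hF.tree.root → (horizontalGraph n r F).Reachable (g x) (hF.tree.parent x)) ∧
      (∀ x y, x ≠ hF.tree.root → (horizontalGraph n r F).Reachable x y → g x = g y) ∧
      ∀ u, {x | x ≠ hF.tree.root ∧ g x = u}.encard =
        (suffixes n r (hF.tree.level u)).encard := by
  choose G h1 h2 h3 using hF.exists_assignment_of_component hR
  refine ⟨fun x => G ((horizontalGraph n r F).connectedComponentMk (hF.tree.parent x)) x,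
    fun x hx => SimpleGraph.ConnectedComponent.exact (h1 _ x hx rfl), fun x y hx hxy => ?_,
    fun u => ?_⟩
  · have : (horizontalGraph n r F).connectedComponentMk (hF.tree.parent y) =
        (horizontalGraph n r F).connectedComponentMk (hF.tree.parent x) :=
      SimpleGraph.ConnectedComponent.sound
        (hF.isCompatible_horizontalGraph.parent_rel (SimpleGraph.Reachable.symm hxy))
    simp only [this]
    exact h2 _ x y hx rfl hxy
  · rw [← h3 _ u rfl]
    congr 1
    ext x
    refine and_congr_right fun hx => ⟨fun h => ?_, fun ⟨h, h'⟩ => ?_⟩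
    · have hc := h1 _ x hx rfl
      rw [show G _ x = u from h] at hc
      exact ⟨hc.symm, hc ▸ h⟩
    · change G _ x = u
      rw [h, h']

end IsMoranStructure

end Moran

theorem theorem4p4 {d : ℕ} (J : Set (EuclideanSpace ℝ (Fin d))) (n : ℕ → ℕ) (r : ℕ → ℝ)
    (F : List ℕ → Set (EuclideanSpace ℝ (Fin d))) (hF : Moran.IsMoranStructure J n r F)
    (hR : Moran.IsRearrangeable n r F) :
    HypGraph.IsHyperbolic (Moran.augmentedTree n r F) (Moran.root n r) ∧
    HypGraph.IsHyperbolic (Moran.verticalGraph n r) (Moran.root n r) ∧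
    (∃ σ : Moran.Vertex n r → Moran.Vertex n r,
      HypGraph.IsNearIsometry (Moran.augmentedTree n r F) (Moran.verticalGraph n r) σ ∧
      (∀ m x, x ∈ Moran.levelSet n r m → σ x ∈ Moran.levelSet n r m) ∧
      (∀ m T, 1 ≤ m → Moran.IsHorizontalComponent n r F m T →
        ∃ p, ∀ x ∈ T, Moran.IsParent p (σ x))) ∧
    (∀ a : ℝ,
      HypGraph.Admissible (Moran.augmentedTree n r F) (Moran.root n r) a →
      HypGraph.Admissible (Moran.verticalGraph n r) (Moran.root n r) a →
      HypGraph.LipschitzEquivalent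
        (HypGraph.boundary (Moran.augmentedTree n r F) (Moran.root n r) a)
        (HypGraph.boundary (Moran.verticalGraph n r) (Moran.root n r) a)) := by
  obtain ⟨M, hM⟩ := hR.1
  have hA := hF.isAugmentation_augmentedTree hM
  have hV := hF.isAugmentation_verticalGraph
  obtain ⟨g, hg, hgs, hcard⟩ := hF.exists_assignment hR
  obtain ⟨σ, hσ, hpar⟩ := LeveledTree.exists_perm_parent_eq g
    (fun x hx => hF.isCompatible_horizontalGraph.level_eq (hg x hx)) hF.finite_children
    fun u v huv => by rw [hcard, hF.encard_children, huv]
  have hdist := hA.abs_dist_sub_le hV hσ hpar hg hgs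
  refine ⟨hA.isHyperbolic, hV.isHyperbolic, ⟨σ, ⟨σ.bijective, M + 2, by positivity, hdist⟩,
    fun m x hx => ?_, fun m T hm hT => ?_⟩, fun a ha _ => ?_⟩
  · rw [hF.mem_levelSet_tree] at hx ⊢
    rw [hσ, hx]
  · obtain ⟨hTm, c, rfl⟩ := hT
    obtain ⟨x, rfl⟩ := c.exists_rep
    have hne : ∀ y, hF.tree.level y = m → y ≠ hF.tree.root := by
      rintro _ hy rfl
      rw [hF.tree.level_root] at hy
      omega
    -- Since `g` is constant on the component, any representative `x` gives the common parent.
    refine ⟨σ (g x), fun y hy => hF.isParent_iff.2 ?_⟩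
    have hym := hF.mem_levelSet_tree.1 (hTm hy)
    refine ⟨hne _ ((hσ y).trans hym), ?_⟩
    rw [hpar y (hne y hym), hgs y x (hne y hym) (SimpleGraph.ConnectedComponent.exact hy)]
  · exact HypGraph.lipschitzEquivalent_boundary σ ha.1 (HypGraph.abs_gromovProduct_sub_le
      (fun x => (hV.dist_root (σ x)).trans ((hσ x).trans (hA.dist_root x).symm)) hdist)

end
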